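/- Let $X$ be a real Hilbert space and $n\ge 2$. Let $A_1,\dots,A_n:X\rightrightarrows X$ be maximally monotone and let $B_1,\dots,B_{n-1}:X\to X$ be $\beta$-cocoercive for some $\beta>0$, i.e. $\langle B_ix-B_iy,x-y\rangle\ge\frac1\beta\|B_ix-B_iy\|^2$ for all $x,y\in X$. Write $J_A=(\mathrm{Id}+A)^{-1}$ for the resolvent, and give $X^{n-1}$ the norm $\|\mathbf z\|=(\sum_i\|\mathbf z_i\|^2)^{1/2}$. Let $G$ be a connected directed graph without multiple arcs on the nodes $1,\dots,n$, such that $i<j$ for every arc $(i,j)$. Write $j\to i$ if $(j,i)$ is an arc of $G$. Let $\kappa_i$ be the degree and $\kappa_i^+$ the in-degree of node $i$ in $G$, and put $c_i=\kappa_i-2\kappa_i^+$. Let $h:\{2,\dots,n\}\to\{1,\dots,n-1\}$ satisfy $h(i)<i$ for all $i$ (for instance $h(i)\to i$). Let $G'$ be a subgraph of $G$ with the nodes $1,\dots,n$ and $n-1$ arcs listed in a fixed order, and let $\mathrm{Inc}(G')\in\mathbb R^{n\times(n-1)}$ be its incidence matrix: the column of an arc $(i,j)$ has entry $1$ at $i$,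 $-1$ at $j$, and $0$ elsewhere. For $\gamma,\theta>0$ and $\mathbf z\in X^{n-1}$ define successively $$\mathbf x_1^\gamma(\mathbf z)=J_{\frac{\gamma}{\kappa_1}A_1}\Big(\tfrac1{\kappa_1}\sum_{e=1}^{n-1}\mathrm{Inc}(G')_{1e}\mathbf z_e\Big),$$ $$\mathbf x_i^\gamma(\mathbf z)=J_{\frac{\gamma}{\kappa_i}A_i}\Big(\tfrac2{\kappa_i}\sum_{j\to i}\mathbf x_j^\gamma(\mathbf z)-\tfrac{\gamma}{\kappa_i}B_{i-1}\mathbf x_{h(i)}^\gamma(\mathbf z)+\tfrac1{\kappa_i}\sum_{e=1}^{n-1}\mathrm{Inc}(G')_{ie}\mathbf z_e\Big),\quad i=2,\dots,n,$$ and the iteration operator $T_{\theta,\gamma}:X^{n-1}\to X^{n-1}$, $(T_{\theta,\gamma}\mathbf z)_e=\mathbf z_e-\theta\sum_{j=1}^n\mathrm{Inc}(G')_{je}\mathbf x_j^\gamma(\mathbf z)$. Consider the following three choices of $G'$ (arcs listed in the order of $i$), operators $Q_{\delta\leftarrow\gamma}$ on $X^{n-1}$ and constants $\mathcal L_{\delta\leftarrow\gamma}$,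 for $\delta,\gamma>0$ and $i=1,\dots,n-1$. 1. Inward star, arcs $(i,n)$, $i=1,\dots,n-1$: $(Q_{\delta\leftarrow\gamma}\mathbf z)_i=\frac\delta\gamma\mathbf z_i+(1-\frac\delta\gamma)\,c_i\,\mathbf x_1^\gamma(\mathbf z)$, with $\mathcal L_{\delta\leftarrow\gamma}=\max\Big\{1,\frac\delta\gamma+\big|1-\frac\delta\gamma\big|\frac1{\kappa_1}\sqrt{\kappa_1^2+\sum_{i=1}^{n-1}c_i^2}\Big\}$. 2. Outward star, arcs $(1,i+1)$, $i=1,\dots,n-1$: $(Q_{\delta\leftarrow\gamma}\mathbf z)_i=\frac\delta\gamma\mathbf z_i-(1-\frac\delta\gamma)\,c_{i+1}\,\mathbf x_1^\gamma(\mathbf z)$, with $\mathcal L_{\delta\leftarrow\gamma}=\max\Big\{1,\frac\delta\gamma+\big|1-\frac\delta\gamma\big|\frac{\sqrt{n-1}}{\kappa_1}\sqrt{\sum_{i=2}^{n}c_i^2}\Big\}$. 3. Sequential graph, arcs $(i,i+1)$, $i=1,\dots,n-1$: $(Q_{\delta\leftarrow\gamma}\mathbf z)_i=\frac\delta\gamma\mathbf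 z_i+(1-\frac\delta\gamma)\big(\sum_{j=1}^ic_j\big)\mathbf x_1^\gamma(\mathbf z)$, with $\mathcal L_{\delta\leftarrow\gamma}=\max\Big\{1,\frac\delta\gamma+\big|1-\frac\delta\gamma\big|\frac1{\kappa_1}\sqrt{\sum_{i=1}^{n-1}\big(\sum_{j=1}^ic_j\big)^2}\Big\}$. In each of the three cases, if $G'$ is a subgraph of $G$, then for every $\theta>0$ the operators $(Q_{\delta\leftarrow\gamma})_{\delta,\gamma>0}$ are fixed-point relocators for $(T_{\theta,\gamma})_{\gamma>0}$ with Lipschitz constants $\mathcal L_{\delta\leftarrow\gamma}\in[1,+\infty)$, that is, for all $\gamma,\delta,\varepsilon>0$: (a) $Q_{\delta\leftarrow\gamma}$ restricts to a bijection from $\mathrm{Fix}\,T_{\theta,\gamma}$ onto $\mathrm{Fix}\,T_{\theta,\delta}$; (b) for every $\mathbf z\in\mathrm{Fix}\,T_{\theta,\gamma}$ the map $\delta\mapsto Q_{\delta\leftarrow\gamma}\mathbf z$ is continuous on $(0,+\infty)$; (c) $Q_{\varepsilon\leftarrow\delta}Q_{\delta\leftarrow\gamma}\mathbf z=Q_{\varepsilon\leftarrow\gamma}\mathbf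 z$ for every $\mathbf z\in\mathrm{Fix}\,T_{\theta,\gamma}$; (d) $Q_{\delta\leftarrow\gamma}$ is $\mathcal L_{\delta\leftarrow\gamma}$-Lipschitz continuous on $X^{n-1}$. Moreover, for all $\delta,\gamma>0$ and all $\mathbf z\in X^{n-1}$, $$\mathbf x_1^\delta(Q_{\delta\leftarrow\gamma}\mathbf z)=\mathbf x_1^\gamma(\mathbf z).$$ -/

import Mathlib

open scoped Pointwise RealInnerProductSpace

namespace GraphFB

section Operators

variable {X : Type*} [NormedAddCommGroup X] [InnerProductSpace ℝ X]

/-- A set-valued operator `A : X ⇉ X` is monotone. -/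
def IsMonotone (A : X → Set X) : Prop :=
  ∀ x u y v : X, y ∈ A x → v ∈ A u → 0 ≤ ⟪x - u, y - v⟫

/-- A set-valued operator is maximally monotone: it is monotone and has no proper monotone
extension. -/
def IsMaximallyMonotone (A : X → Set X) : Prop :=
  IsMonotone A ∧ ∀ A' : X → Set X, IsMonotone A' → (∀ x, A x ⊆ A' x) → A' = A

/-- `T` is `β`-cocoercive (in the normalisation in which it is then `β`-Lipschitz). -/
def IsCocoercive (β : ℝ) (T : X → X) : Prop :=
  ∀ x y : X, (1 / β) * ‖T x - T y‖ ^ 2 ≤ ⟪T x - T y, x - y⟫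

/-- The resolvent `J_A = (Id + A)⁻¹`: a point `p` with `x ∈ p + A p`. For maximally monotone `A`
on a Hilbert space there is exactly one such `p`; the value is irrelevant if there is none. -/
noncomputable def resolvent (A : X → Set X) (x : X) : X :=
  Classical.epsilon fun p => ∃ u ∈ A p, p + u = x

/-- `(Q δ γ)`, for `γ, δ ∈ Γ`, are fixed-point relocators for `(T γ)`, `γ ∈ Γ`, with Lipschitz
constants `(L δ γ)`. Here `Q δ γ` is the operator relocating from `γ` to `δ`. -/
structure IsFixedPointRelocator (Γ : Set ℝ) (T : ℝ → X → X) (Q : ℝ → ℝ → X → X)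
    (L : ℝ → ℝ → ℝ) : Prop where
  nonempty : Γ.Nonempty
  pos : ∀ γ ∈ Γ, 0 < γ
  one_le : ∀ γ ∈ Γ, ∀ δ ∈ Γ, 1 ≤ L δ γ
  bijOn : ∀ γ ∈ Γ, ∀ δ ∈ Γ,
    Set.BijOn (Q δ γ) (Function.fixedPoints (T γ)) (Function.fixedPoints (T δ))
  continuousOn : ∀ γ ∈ Γ, ∀ x ∈ Function.fixedPoints (T γ), ContinuousOn (fun δ => Q δ γ x) Γ
  semigroup : ∀ γ ∈ Γ, ∀ δ ∈ Γ, ∀ ε ∈ Γ, ∀ x ∈ Function.fixedPoints (T γ),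
    Q ε δ (Q δ γ x) = Q ε γ x
  lipschitz : ∀ γ ∈ Γ, ∀ δ ∈ Γ, ∀ x y : X, ‖Q δ γ x - Q δ γ y‖ ≤ L δ γ * ‖x - y‖

end Operators

section Graphs

/-- The degree `κ_i` of a node: the number of nodes joined to it by an arc, in either direction. -/
noncomputable def degree {V : Type*} (G : Digraph V) (i : V) : ℕ :=
  {j | G.Adj i j ∨ G.Adj j i}.ncard

/-- The in-degree `κ_i⁺` of a node. -/
noncomputable def inDegree {V : Type*} (G : Digraph V) (i : V) : ℕ :=
  {j | G.Adj j i}.ncard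

/-- The signed degree `κ_i - 2 κ_i⁺`. -/
noncomputable def signedDegree {V : Type*} (G : Digraph V) (i : V) : ℝ :=
  (degree G i : ℝ) - 2 * (inDegree G i : ℝ)

/-- The directed graph whose arcs are the pairs listed by `arc`. -/
def digraphOfArcs {V E : Type*} (arc : E → V × V) : Digraph V :=
  ⟨fun i j => ∃ e, arc e = (i, j)⟩

/-- The incidence matrix of the directed graph whose arcs are listed (without repetition) by
`arc`: in the column of the arc `e = (i, j)` the entry is `1` at `i`, `-1` at `j`, `0` elsewhere. -/
def incidence {V E : Type*} [DecidableEq V] (arc : E → V × V) : Matrix V E ℝ :=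
  Matrix.of fun i e => if (arc e).1 = i then 1 else if (arc e).2 = i then -1 else 0

/-- Inward star on the nodes `1, …, n` with `n = m + 1`: the arcs are `(i, n)`, `i = 1, …, n - 1`. -/
def inwardStarArc (m : ℕ) (e : Fin m) : Fin (m + 1) × Fin (m + 1) := (e.castSucc, Fin.last m)

/-- Outward star: the arcs are `(1, i)`, `i = 2, …, n`. -/
def outwardStarArc (m : ℕ) (e : Fin m) : Fin (m + 1) × Fin (m + 1) := (0, e.succ)

/-- Sequential graph: the arcs are `(i, i + 1)`, `i = 1, …, n - 1`. -/
def sequentialArc (m : ℕ) (e : Fin m) : Fin (m + 1) × Fin (m + 1) := (e.castSucc, e.succ)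

end Graphs

section Method

variable {X : Type*} [NormedAddCommGroup X] [InnerProductSpace ℝ X] {m : ℕ}

open Classical in
/-- The points `x_i^γ(z)`, `i = 1, …, n`, where `n = m + 1`, nodes are indexed by `Fin (m + 1)`
from `0`, and the node `i.succ` carries the single-valued operator `B i` evaluated at
`x_{h i}^γ(z)`. The matrix `M` is the incidence matrix of the subgraph; the predecessors and
degrees are those of `G`. -/
noncomputable def resolventPoint (G : Digraph (Fin (m + 1))) (hG : ∀ i j, G.Adj i j → i < j)
    (h : Fin m → Fin (m + 1)) (hh : ∀ i, h i < i.succ)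
    (A : Fin (m + 1) → X → Set X) (B : Fin m → X → X) (M : Matrix (Fin (m + 1)) (Fin m) ℝ)
    (γ : ℝ) (z : PiLp 2 fun _ : Fin m => X) (i : Fin (m + 1)) : X :=
  if hi : i = 0 then
    resolvent ((γ / degree G i) • A i) ((1 / (degree G i : ℝ)) • ∑ e, M i e • z e)
  else
    resolvent ((γ / degree G i) • A i)
      ((2 / (degree G i : ℝ)) •
          ∑ j : {j // G.Adj j i}, resolventPoint G hG h hh A B M γ z j.1
        - (γ / degree G i) •
          B (i.pred hi) (resolventPoint G hG h hh A B M γ z (h (i.pred hi)))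
        + (1 / (degree G i : ℝ)) • ∑ e, M i e • z e)
termination_by i
decreasing_by
  · exact hG _ _ j.2
  · simpa using hh (i.pred hi)

/-- The iteration operator `T_{θ,γ}` on `X^{n-1}`:
`(T_{θ,γ} z)_e = z_e - θ ∑_j M_{j e} x_j^γ(z)`. -/
noncomputable def iterationOperator (G : Digraph (Fin (m + 1)))
    (hG : ∀ i j, G.Adj i j → i < j) (h : Fin m → Fin (m + 1)) (hh : ∀ i, h i < i.succ)
    (A : Fin (m + 1) → X → Set X) (B : Fin m → X → X) (M : Matrix (Fin (m + 1)) (Fin m) ℝ)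
    (θ γ : ℝ) (z : PiLp 2 fun _ : Fin m => X) : PiLp 2 fun _ : Fin m => X :=
  WithLp.toLp 2 fun e => z e - θ • ∑ j, M j e • resolventPoint G hG h hh A B M γ z j

/-- The operator `z ↦ (δ/γ) z + (1 - δ/γ) (κ_i - 2κ_i⁺)_{i=1}^{n-1} ⊗ x_1^γ(z)`, given
`x₁ γ z = x_1^γ(z)`. -/
noncomputable def inwardStarRelocator (G : Digraph (Fin (m + 1)))
    (x₁ : ℝ → (PiLp 2 fun _ : Fin m => X) → X) (δ γ : ℝ) (z : PiLp 2 fun _ : Fin m => X) :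
    PiLp 2 fun _ : Fin m => X :=
  (δ / γ) • z + (1 - δ / γ) • WithLp.toLp 2 fun i => signedDegree G i.castSucc • x₁ γ z

/-- The operator `z ↦ (δ/γ) z - (1 - δ/γ) (κ_i - 2κ_i⁺)_{i=2}^{n} ⊗ x_1^γ(z)`. -/
noncomputable def outwardStarRelocator (G : Digraph (Fin (m + 1)))
    (x₁ : ℝ → (PiLp 2 fun _ : Fin m => X) → X) (δ γ : ℝ) (z : PiLp 2 fun _ : Fin m => X) :
    PiLp 2 fun _ : Fin m => X :=
  (δ / γ) • z - (1 - δ / γ) • WithLp.toLp 2 fun i => signedDegree G i.succ • x₁ γ z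

/-- The operator
`z ↦ (δ/γ) z + (1 - δ/γ) (∑_{j ≤ i} (κ_j - 2κ_j⁺))_{i=1}^{n-1} ⊗ x_1^γ(z)`. -/
noncomputable def sequentialRelocator (G : Digraph (Fin (m + 1)))
    (x₁ : ℝ → (PiLp 2 fun _ : Fin m => X) → X) (δ γ : ℝ) (z : PiLp 2 fun _ : Fin m => X) :
    PiLp 2 fun _ : Fin m => X :=
  (δ / γ) • z + (1 - δ / γ) •
    WithLp.toLp 2 fun i : Fin m => (∑ j ∈ Finset.Iic i.castSucc, signedDegree G j) • x₁ γ z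

/-- Lipschitz constant of the inward-star relocator. -/
noncomputable def inwardStarLipschitz (G : Digraph (Fin (m + 1))) (δ γ : ℝ) : ℝ :=
  max 1 (δ / γ + |1 - δ / γ| * (1 / (degree G 0 : ℝ)) *
    √((degree G 0 : ℝ) ^ 2 + ∑ i : Fin m, signedDegree G i.castSucc ^ 2))

/-- Lipschitz constant of the outward-star relocator. -/
noncomputable def outwardStarLipschitz (G : Digraph (Fin (m + 1))) (δ γ : ℝ) : ℝ :=
  max 1 (δ / γ + |1 - δ / γ| * (√(m : ℝ) / (degree G 0 : ℝ)) *
    √(∑ i : Fin m, signedDegree G i.succ ^ 2))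

/-- Lipschitz constant of the sequential relocator. -/
noncomputable def sequentialLipschitz (G : Digraph (Fin (m + 1))) (δ γ : ℝ) : ℝ :=
  max 1 (δ / γ + |1 - δ / γ| * (1 / (degree G 0 : ℝ)) *
    √(∑ i : Fin m, (∑ j ∈ Finset.Iic i.castSucc, signedDegree G j) ^ 2))

end Method

end GraphFB

open GraphFB

/-!
Everything rests on how the resolvent equations depend on the step size. Since `A i` is maximally
monotone, the point `x_i = J_{(γ/κ_i) A_i}(w / κ_i)` is characterised by the inclusion
`w - κ_i x_i ∈ γ A_i x_i`. A point `z` is fixed by `T_{θ,γ}` iff `x_1, …, x_n` have a common value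
`x`, as the subgraph is connected, and by the characterisation this means
`(M z)_i - c_i x ∈ γ (A_i + B_{i-1}) x` for all nodes `i`, where `M` is the incidence matrix and
`c_i = κ_i - 2 κ_i⁺` (`resolventPoint_eq_const_iff`). The step size only scales the right-hand
side. Hence, if `a` solves `M a = c`, then `Q z = r z + (1 - r) a ⊗ x` with `r = δ / γ` satisfies
`(M Q z)_i - c_i x = r ((M z)_i - c_i x)` and is fixed by `T_{θ,δ}` with the same common value `x`.
For node `1`, where `κ_1 = c_1`, this argument applies to every `z`, fixed or not, so that
`x_1^δ (Q z) = x_1^γ z`; the semigroup law and bijectivity follow formally from this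
(`isFixedPointRelocator_weightedRelocator`). The Lipschitz
estimate for `Q` is the triangle inequality: `z ↦ x_1^γ z` is Lipschitz with constant `1 / κ_1`
times the norm of the first row of `M`, and tensoring with `a` contributes the norm of `a`.

The three relocators are the instances in which `M` is the incidence matrix of a tree and `a` is
the solution of `M a = c`, which exists because the entries of `c` (out-degree minus in-degree)
add up to `0`.

That resolvents are defined everywhere is Minty's theorem
(`IsMaximallyMonotone.exists_add_smul_eq`). It is proved by minimising the sum of the Fitzpatrick
function of `A` and `‖·‖² / 2` over `X × X`. This sum is a supremum of translates of `‖·‖² / 2`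
shifted by constants, so a minimiser exists and the function grows quadratically away from it
(`exists_minimizer_sSup_sq`); the growth estimate yields a point of the graph of `A` at
which the resolvent inclusion holds.
-/

namespace GraphFB

/-! ### Maximally monotone operators and Minty's theorem -/

open Filter Topology in
/-- The function `w ↦ ⨆ i, (‖w + s i‖ ^ 2 / 2 - d i)` with values in `(-∞, ∞]`, if finite somewhere,
attains its minimum `μ`, and it grows quadratically away from the minimiser. The supremum is
encoded by its upper bounds `t`, which avoids extended real values. -/
theorem exists_minimizer_sSup_sq {E ι : Type*} [NormedAddCommGroup E] [InnerProductSpace ℝ E]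
    [CompleteSpace E] [Nonempty ι] (s : ι → E) (d : ι → ℝ)
    (hfeas : ∃ w : E, ∃ t : ℝ, ∀ i, ‖w + s i‖ ^ 2 / 2 - d i ≤ t) :
    ∃ w₀ : E, ∃ μ : ℝ, (∀ i, ‖w₀ + s i‖ ^ 2 / 2 - d i ≤ μ) ∧
      ∀ w t, (∀ i, ‖w + s i‖ ^ 2 / 2 - d i ≤ t) → μ + ‖w - w₀‖ ^ 2 / 2 ≤ t := by
  let K : ℝ → Set E := fun t => {w | ∀ i, ‖w + s i‖ ^ 2 / 2 - d i ≤ t}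
  have hKmono : ∀ {t t'}, t ≤ t' → K t ⊆ K t' := fun h w hw i => (hw i).trans h
  have hcomb : ∀ {w w' : E} {t t' : ℝ}, w ∈ K t → w' ∈ K t' → ∀ r : ℝ, 0 ≤ r → r ≤ 1 →
      w + r • (w' - w) ∈ K ((1 - r) * t + r * t' - r * (1 - r) * (‖w' - w‖ ^ 2 / 2)) := by
    intro w w' t t' hw hw' r hr0 hr1 i
    have key : ‖w + r • (w' - w) + s i‖ ^ 2 =
        (1 - r) * ‖w + s i‖ ^ 2 + r * ‖w' + s i‖ ^ 2 - r * (1 - r) * ‖w' - w‖ ^ 2 := by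
      have e1 : w' + s i = (w + s i) + (w' - w) := by abel
      have e2 : w + r • (w' - w) + s i = (w + s i) + r • (w' - w) := by abel
      rw [e1, e2, norm_add_sq_real (w + s i), norm_add_sq_real (w + s i), norm_smul,
        inner_smul_right, mul_pow, Real.norm_eq_abs, sq_abs]
      ring
    have h1 := mul_le_mul_of_nonneg_left (hw i) (sub_nonneg.2 hr1)
    have h2 := mul_le_mul_of_nonneg_left (hw' i) hr0
    rw [key]
    linarith
  let V : Set ℝ := {t | (K t).Nonempty}
  have hV : V.Nonempty := let ⟨w, t, h⟩ := hfeas; ⟨t, w, h⟩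
  have hVb : BddBelow V := by
    obtain ⟨i⟩ := ‹Nonempty ι›
    refine ⟨-d i, ?_⟩
    rintro t ⟨w, hw⟩
    have := hw i
    nlinarith [sq_nonneg ‖w + s i‖]
  set μ := sInf V with hμ
  have hle : ∀ {w t}, w ∈ K t → μ ≤ t := fun hw => csInf_le hVb ⟨_, hw⟩
  have hclosed : ∀ t, IsClosed (K t) := fun t => by
    have : K t = ⋂ i, {w | ‖w + s i‖ ^ 2 / 2 - d i ≤ t} := by ext; simp [K]
    rw [this]
    exact isClosed_iInter fun i => isClosed_le (by fun_prop) continuous_const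
  -- Two points of `K t` are close for `t` near `μ`, since their midpoint lies in a smaller set.
  have hdist : ∀ {t w w'}, w ∈ K t → w' ∈ K t → dist w w' ≤ √(8 * (t - μ)) := by
    intro t w w' hw hw'
    have := hle (hcomb hw hw' (1 / 2) (by norm_num) (by norm_num))
    rw [dist_comm, dist_eq_norm]
    exact Real.le_sqrt_of_sq_le (by linarith)
  have hne : ∀ t, μ < t → (K t).Nonempty := fun t ht => by
    obtain ⟨t', ⟨w, hw⟩, h⟩ := exists_lt_of_csInf_lt hV ht
    exact ⟨w, hKmono h.le hw⟩
  let τ : ℕ → ℝ := fun n => μ + 1 / ((n : ℝ) + 1)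
  have hτ : ∀ n, μ < τ n := fun n => by
    have : (0 : ℝ) < 1 / ((n : ℝ) + 1) := by positivity
    simp only [τ]; linarith
  have hτa : Antitone τ := fun n k hnk => by
    simp only [τ]; gcongr
  have hτlim : Tendsto τ atTop (𝓝 μ) := by
    simpa [τ] using (tendsto_const_nhds (x := μ)).add tendsto_one_div_add_atTop_nhds_zero_nat
  obtain ⟨w₀, hw₀⟩ : (⋂ n, K (τ n)).Nonempty := by
    refine Metric.nonempty_iInter_of_nonempty_biInter (fun n => hclosed _) (fun n => ?_)
      (fun N => ?_) ?_
    · exact Metric.isBounded_iff.2 ⟨_, fun x hx y hy => hdist hx hy⟩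
    · obtain ⟨w, hw⟩ := hne _ (hτ N)
      exact ⟨w, Set.mem_iInter₂.2 fun n hn => hKmono (hτa hn) hw⟩
    · have h0 : Tendsto (fun n => √(8 * (τ n - μ))) atTop (𝓝 0) := by
        have := ((hτlim.sub_const μ).const_mul 8).sqrt
        simpa using this
      exact squeeze_zero (fun n => Metric.diam_nonneg)
        (fun n => Metric.diam_le_of_forall_dist_le (Real.sqrt_nonneg _)
          fun x hx y hy => hdist hx hy) h0
  have hmem : w₀ ∈ K μ := fun i =>
    ge_of_tendsto' hτlim fun n => Set.mem_iInter.1 hw₀ n i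
  refine ⟨w₀, μ, hmem, fun w t hw => ?_⟩
  -- Compare `w₀` with the points `w₀ + r (w - w₀)` and let `r` tend to `0`.
  have hr : ∀ r : ℝ, 0 < r → r < 1 → μ + (1 - r) * (‖w - w₀‖ ^ 2 / 2) ≤ t := by
    intro r h0 h1
    have h := hle (hcomb hmem hw r h0.le h1.le)
    refine le_of_mul_le_mul_left ?_ h0
    linarith
  have hlim : Tendsto (fun r : ℝ => μ + (1 - r) * (‖w - w₀‖ ^ 2 / 2)) (𝓝[>] 0)
      (𝓝 (μ + ‖w - w₀‖ ^ 2 / 2)) := by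
    have : Continuous fun r : ℝ => μ + (1 - r) * (‖w - w₀‖ ^ 2 / 2) := by fun_prop
    simpa using (this.tendsto 0).mono_left nhdsWithin_le_nhds
  refine le_of_tendsto hlim ?_
  filter_upwards [Ioo_mem_nhdsGT (zero_lt_one' ℝ)] with r hr'
  exact hr r hr'.1 hr'.2

variable {X : Type*} [NormedAddCommGroup X] [InnerProductSpace ℝ X]

/-- A pair that is monotonically related to the graph of a maximally monotone operator lies in it.
-/
theorem IsMaximallyMonotone.mem_of_forall_inner_nonneg {A : X → Set X}
    (hA : IsMaximallyMonotone A) {p q : X} (h : ∀ a, ∀ u ∈ A a, 0 ≤ ⟪p - a, q - u⟫) :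
    q ∈ A p := by
  have hext : (fun x => A x ∪ {u | x = p ∧ u = q}) = A := by
    refine hA.2 _ ?_ fun x => Set.subset_union_left
    rintro x u y v (hy | ⟨rfl, rfl⟩) (hv | ⟨rfl, rfl⟩)
    · exact hA.1 x u y v hy hv
    · have := h x y hy
      rwa [← neg_sub x, ← neg_sub y, inner_neg_neg] at this
    · exact h u v hv
    · simp
  rw [← congrFun hext p]
  exact Or.inr ⟨rfl, rfl⟩

/-- Zero is in the range of `Id + A`. The hypothesis `hmax` is the form of maximality that survives
scaling and translating the values of `A`. -/
theorem exists_neg_mem_of_monotone [CompleteSpace X] {A : X → Set X} (hmono : IsMonotone A)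
    (hmax : ∀ p q : X, (∀ a, ∀ u ∈ A a, 0 ≤ ⟪p - a, q - u⟫) → q ∈ A p) :
    ∃ p, -p ∈ A p := by
  let ι := {a : X × X // a.2 ∈ A a.1}
  let s : ι → WithLp 2 (X × X) := fun a => WithLp.toLp 2 (a.1.2, a.1.1)
  let d : ι → ℝ := fun a => ⟪a.1.1, a.1.2⟫ + ‖s a‖ ^ 2 / 2
  have hval : ∀ (w : WithLp 2 (X × X)) (a : ι), ‖w + s a‖ ^ 2 / 2 - d a =
      ‖w‖ ^ 2 / 2 + ⟪w.fst, w.snd⟫ - ⟪w.fst - a.1.1, w.snd - a.1.2⟫ := by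
    intro w a
    simp only [d, norm_add_sq_real, WithLp.prod_inner_apply, s, inner_sub_left, inner_sub_right]
    rw [real_inner_comm a.1.1 w.ofLp.2]
    change _ = ‖w‖ ^ 2 / 2 + ⟪w.ofLp.1, w.ofLp.2⟫ - (⟪w.ofLp.1, w.ofLp.2⟫ - ⟪a.1.1, w.ofLp.2⟫ -
      (⟪w.ofLp.1, a.1.2⟫ - ⟪a.1.1, a.1.2⟫))
    ring
  obtain ⟨a₀⟩ : Nonempty ι := by
    by_contra hne
    exact hne ⟨⟨(0, 0), hmax 0 0 fun a u hu => (hne ⟨⟨(a, u), hu⟩⟩).elim⟩⟩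
  have : Nonempty ι := ⟨a₀⟩
  -- On the graph of `A` the Fitzpatrick function is the duality product.
  have hgraph : ∀ a b : ι, ‖WithLp.toLp 2 a.1 + s b‖ ^ 2 / 2 - d b ≤
      ‖WithLp.toLp 2 a.1‖ ^ 2 / 2 + ⟪a.1.1, a.1.2⟫ := by
    intro a b
    rw [hval]
    have := hmono _ _ _ _ a.2 b.2
    simpa using this
  obtain ⟨w₀, μ, hw₀, hmin⟩ := exists_minimizer_sSup_sq s d ⟨_, _, hgraph a₀⟩
  set p := w₀.fst with hp
  set q := w₀.snd with hq
  have hsq : ‖w₀‖ ^ 2 = ‖p‖ ^ 2 + ‖q‖ ^ 2 := WithLp.prod_norm_sq_eq_of_L2 w₀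
  -- The Fitzpatrick function dominates the duality product, by maximality.
  have hμ : ‖w₀‖ ^ 2 / 2 + ⟪p, q⟫ ≤ μ := by
    by_contra! hlt
    have hpos : ∀ a u, u ∈ A a → 0 < ⟪p - a, q - u⟫ := fun a u hu => by
      have := hw₀ ⟨(a, u), hu⟩
      rw [hval] at this
      linarith
    have := hpos p q (hmax p q fun a u hu => (hpos a u hu).le)
    simp at this
  have hineq : ∀ a u, u ∈ A a → ‖p + q‖ ^ 2 ≤ ⟪-q - a, -p - u⟫ := by
    intro a u hu
    have h := hmin _ _ (hgraph ⟨(a, u), hu⟩)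
    rw [norm_sub_sq_real, WithLp.prod_inner_apply] at h
    change μ + (‖WithLp.toLp 2 (a, u)‖ ^ 2 - 2 * (⟪a, p⟫ + ⟪u, q⟫) + _) / 2 ≤
      ‖WithLp.toLp 2 (a, u)‖ ^ 2 / 2 + ⟪a, u⟫ at h
    rw [norm_add_sq_real]
    simp only [inner_sub_left, inner_sub_right, inner_neg_left, inner_neg_right]
    rw [real_inner_comm p q, real_inner_comm u q]
    linarith
  have hmem : -p ∈ A (-q) := hmax _ _ fun a u hu => (sq_nonneg _).trans (hineq a u hu)
  have h0 : p + q = 0 := by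
    have := hineq _ _ hmem
    simpa using this
  exact ⟨p, by rwa [← eq_neg_of_add_eq_zero_left h0] at hmem⟩

/-- Minty's theorem: `Id + c A` is surjective. It reduces to `exists_neg_mem_of_monotone` for the
operator `x ↦ c A x - y`. -/
theorem IsMaximallyMonotone.exists_add_smul_eq [CompleteSpace X] {A : X → Set X}
    (hA : IsMaximallyMonotone A) {c : ℝ} (hc : 0 < c) (y : X) : ∃ p, ∃ u ∈ A p, p + c • u = y := by
  have hmono : IsMonotone fun x => {v | c⁻¹ • (v + y) ∈ A x} := by
    intro x u v w hv hw
    have := hA.1 _ _ _ _ hv hw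
    rw [← smul_sub, add_sub_add_right_eq_sub, inner_smul_right] at this
    exact (mul_nonneg_iff_of_pos_left (inv_pos.2 hc)).1 this
  have hmax : ∀ p q : X, (∀ a, ∀ u ∈ {v | c⁻¹ • (v + y) ∈ A a}, 0 ≤ ⟪p - a, q - u⟫) →
      q ∈ {v | c⁻¹ • (v + y) ∈ A p} := by
    intro p q h
    refine hA.mem_of_forall_inner_nonneg fun a u hu => ?_
    have := h a (c • u - y) (by
      rwa [Set.mem_ofPred_eq, sub_add_cancel, inv_smul_smul₀ hc.ne'])
    have e : c⁻¹ • (q + y) - u = c⁻¹ • (q - (c • u - y)) := by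
      rw [sub_sub_eq_add_sub, smul_sub, inv_smul_smul₀ hc.ne']
    rw [e, inner_smul_right]
    exact mul_nonneg (inv_pos.2 hc).le this
  obtain ⟨p, hp⟩ := exists_neg_mem_of_monotone hmono hmax
  exact ⟨p, _, hp, by rw [smul_inv_smul₀ hc.ne']; abel⟩

/-- The inverse of `Id + c A` is nonexpansive. -/
theorem IsMonotone.norm_sub_le {A : X → Set X} (hA : IsMonotone A) {c : ℝ} (hc : 0 ≤ c)
    {p p' u u' : X} (hu : u ∈ A p) (hu' : u' ∈ A p') :
    ‖p - p'‖ ≤ ‖(p + c • u) - (p' + c • u')‖ := by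
  have h := mul_nonneg hc (hA _ _ _ _ hu hu')
  have e : (p + c • u) - (p' + c • u') = (p - p') + c • (u - u') := by
    rw [smul_sub]; abel
  rw [e]
  refine le_of_sq_le_sq ?_ (norm_nonneg _)
  rw [norm_add_sq_real, inner_smul_right]
  nlinarith [sq_nonneg ‖c • (u - u')‖]

theorem IsMaximallyMonotone.resolvent_eq_iff [CompleteSpace X] {A : X → Set X}
    (hA : IsMaximallyMonotone A) {c : ℝ} (hc : 0 < c) {y p : X} :
    resolvent (c • A) y = p ↔ ∃ u ∈ A p, p + c • u = y := by
  have hspec : ∃ u ∈ A (resolvent (c • A) y), resolvent (c • A) y + c • u = y := by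
    obtain ⟨p', u, hu, h⟩ := hA.exists_add_smul_eq hc y
    obtain ⟨v, ⟨u', hu', rfl⟩, h'⟩ := Classical.epsilon_spec
      (p := fun p => ∃ u ∈ (c • A) p, p + u = y) ⟨p', c • u, ⟨u, hu, rfl⟩, h⟩
    exact ⟨u', hu', h'⟩
  refine ⟨fun h => h ▸ hspec, ?_⟩
  rintro ⟨u, hu, h⟩
  obtain ⟨u', hu', h'⟩ := hspec
  have := hA.1.norm_sub_le hc.le hu' hu
  rw [h, h', sub_self, norm_zero] at this
  exact sub_eq_zero.1 (norm_le_zero_iff.1 this)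

/-! ### Degrees and incidence matrices -/

section Graph
variable {m : ℕ} {G : Digraph (Fin (m + 1))}

theorem degree_pos_of_connected (hm : 1 ≤ m) (hconn : G.toSimpleGraphInclusive.Connected)
    (i : Fin (m + 1)) : 0 < degree G i := by
  have : Nontrivial (Fin (m + 1)) := Fin.nontrivial_iff_two_le.2 (by omega)
  obtain ⟨j, hj⟩ := hconn.preconnected.exists_adj_of_nontrivial i
  exact (Set.ncard_pos (Set.toFinite _)).2 ⟨j, ((SimpleGraph.fromRel_adj ..).1 hj).2⟩

theorem signedDegree_eq_sub (hG : ∀ i j, G.Adj i j → i < j) (i : Fin (m + 1)) :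
    signedDegree G i = ({j | G.Adj i j}.ncard : ℝ) - {j | G.Adj j i}.ncard := by
  have h : degree G i = {j | G.Adj i j}.ncard + {j | G.Adj j i}.ncard := by
    rw [degree, Set.ofPred_or]
    refine Set.ncard_union_eq (Set.disjoint_left.2 fun j h1 h2 => ?_)
    exact lt_asymm (hG _ _ h1) (hG _ _ h2)
  rw [signedDegree, h, inDegree]
  push_cast
  ring

theorem sum_signedDegree (hG : ∀ i j, G.Adj i j → i < j) : ∑ i, signedDegree G i = 0 := by
  classical
  have hcard : ∀ p : Fin (m + 1) → Prop, ({j | p j}.ncard : ℝ) = ∑ j, if p j then 1 else 0 := by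
    intro p
    simp [Set.ncard_eq_toFinset_card']
  simp only [signedDegree_eq_sub hG, hcard, Finset.sum_sub_distrib]
  rw [Finset.sum_comm, sub_self]

theorem inDegree_zero (hG : ∀ i j, G.Adj i j → i < j) : inDegree G 0 = 0 := by
  have : {j | G.Adj j 0} = ∅ := Set.eq_empty_of_forall_notMem fun j hj =>
    (Fin.not_lt_zero j) (hG _ _ hj)
  rw [inDegree, this, Set.ncard_empty]

theorem signedDegree_zero (hG : ∀ i j, G.Adj i j → i < j) :
    signedDegree G 0 = degree G 0 := by
  simp [signedDegree, inDegree_zero hG]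

/-- Away from loops the incidence matrix is the difference of two indicator functions; at a loop the
definition of `incidence` gives `1` instead of `0`. -/
theorem incidence_apply_of_ne {V E : Type*} [DecidableEq V] {arc : E → V × V} (i : V) {e : E}
    (he : (arc e).1 ≠ (arc e).2) : incidence arc i e =
      (if (arc e).1 = i then 1 else 0) - (if (arc e).2 = i then 1 else 0) := by
  rw [incidence, Matrix.of_apply]
  split_ifs with h1 h2 h2
  · exact (he (h1.trans h2.symm)).elim
  all_goals simp

theorem sum_incidence_smul {V E Y : Type*} [DecidableEq V] [Fintype V] [AddCommGroup Y]
    [Module ℝ Y] {arc : E → V × V} {e : E} (he : (arc e).1 ≠ (arc e).2) (x : V → Y) :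
    ∑ i, incidence arc i e • x i = x (arc e).1 - x (arc e).2 := by
  simp [incidence_apply_of_ne _ he, sub_smul, Finset.sum_sub_distrib, ite_smul]

end Graph

/-! ### Dependence of the resolvent points on the step size -/

section Method
variable {X : Type*} [NormedAddCommGroup X] [InnerProductSpace ℝ X]
  {m : ℕ} {G : Digraph (Fin (m + 1))} {hG : ∀ i j, G.Adj i j → i < j}
  {h : Fin m → Fin (m + 1)} {hh : ∀ i, h i < i.succ}
  {A : Fin (m + 1) → X → Set X} {B : Fin m → X → X} {M : Matrix (Fin (m + 1)) (Fin m) ℝ}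
  {γ : ℝ} {z : PiLp 2 fun _ : Fin m => X}

variable [CompleteSpace X]

/-- The resolvent in the scaling used by the method, rewritten as an inclusion free of `1 / κ`. -/
theorem IsMaximallyMonotone.resolvent_div_eq_iff {A : X → Set X} (hA : IsMaximallyMonotone A)
    {κ : ℝ} (hκ : 0 < κ) (hγ : 0 < γ) {w p : X} :
    resolvent ((γ / κ) • A) ((1 / κ) • w) = p ↔ ∃ u ∈ A p, γ • u = w - κ • p := by
  rw [hA.resolvent_eq_iff (div_pos hγ hκ)]
  refine exists_congr fun u => and_congr_right fun _ => ?_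
  rw [← smul_right_injective X hκ.ne' |>.eq_iff]
  simp only [smul_add, smul_smul, mul_div_cancel₀ _ hκ.ne', one_smul]
  rw [eq_sub_iff_add_eq, add_comm]

theorem resolventPoint_zero_eq_iff (hA : IsMaximallyMonotone (A 0)) (hκ : 0 < degree G 0)
    (hγ : 0 < γ) {p : X} : resolventPoint G hG h hh A B M γ z 0 = p ↔
      ∃ u ∈ A 0 p, γ • u = ∑ e, M 0 e • z e - (degree G 0 : ℝ) • p := by
  rw [resolventPoint, dif_pos rfl, hA.resolvent_div_eq_iff (Nat.cast_pos.2 hκ) hγ]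

/-- If all points computed before node `k.succ` agree, the sum over its predecessors is a multiple
of the common value. -/
theorem resolventPoint_succ_eq_iff {k : Fin m} (hA : IsMaximallyMonotone (A k.succ))
    (hκ : 0 < degree G k.succ) (hγ : 0 < γ) {p q : X}
    (hpred : ∀ j, j < k.succ → resolventPoint G hG h hh A B M γ z j = q) :
    resolventPoint G hG h hh A B M γ z k.succ = p ↔
      ∃ u ∈ A k.succ p, γ • u = ∑ e, M k.succ e • z e + (2 * inDegree G k.succ : ℝ) • q
        - γ • B k q - (degree G k.succ : ℝ) • p := by
  classical
  rw [resolventPoint, dif_neg k.succ_ne_zero]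
  have hsum : ∑ j : {j // G.Adj j k.succ}, resolventPoint G hG h hh A B M γ z j.1 =
      (inDegree G k.succ : ℝ) • q := by
    rw [Finset.sum_congr rfl fun j _ => hpred j.1 (hG _ _ j.2), Finset.sum_const,
      Finset.card_univ, ← Nat.card_eq_fintype_card, inDegree, Nat.cast_smul_eq_nsmul]
    rfl
  have hB : resolventPoint G hG h hh A B M γ z (h k) = q := hpred _ (hh k)
  simp only [Fin.pred_succ]
  rw [hB]
  have e : (2 / (degree G k.succ : ℝ)) •
          ∑ j : {j // G.Adj j k.succ}, resolventPoint G hG h hh A B M γ z j.1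
        - (γ / degree G k.succ) • B k q + (1 / (degree G k.succ : ℝ)) • ∑ e, M k.succ e • z e =
      (1 / (degree G k.succ : ℝ)) • (∑ e, M k.succ e • z e + (2 * inDegree G k.succ : ℝ) • q
        - γ • B k q) := by
    rw [hsum]
    module
  convert hA.resolvent_div_eq_iff (Nat.cast_pos.2 hκ) hγ using 3

/-- The points `x_i^γ(z)` all equal `p` iff `(M z)_i - c_i p ∈ γ (A_i + B_{i-1}) p` for every node
`i`, with `B_0 = 0`. The step size enters only as a factor of the operators. -/
theorem resolventPoint_eq_const_iff (hA : ∀ i, IsMaximallyMonotone (A i))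
    (hκ : ∀ i, 0 < degree G i) (hγ : 0 < γ) {p : X} :
    (∀ i, resolventPoint G hG h hh A B M γ z i = p) ↔
      ∀ i, ∃ u ∈ A i p, γ • (u + (Fin.cons 0 B : Fin (m + 1) → X → X) i p) =
        ∑ e, M i e • z e - signedDegree G i • p := by
  have h0 := resolventPoint_zero_eq_iff (hG := hG) (h := h) (hh := hh) (B := B) (M := M) (z := z)
    (p := p) (hA 0) (hκ 0) hγ
  have hs : ∀ k : Fin m, (∀ j, j < k.succ → resolventPoint G hG h hh A B M γ z j = p) →
      (resolventPoint G hG h hh A B M γ z k.succ = p ↔ ∃ u ∈ A k.succ p,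
        γ • (u + (Fin.cons 0 B : Fin (m + 1) → X → X) k.succ p) =
          ∑ e, M k.succ e • z e - signedDegree G k.succ • p) := by
    intro k hk
    rw [resolventPoint_succ_eq_iff (hA _) (hκ _) hγ hk]
    refine exists_congr fun u => and_congr_right fun _ => ?_
    rw [Fin.cons_succ, smul_add, ← eq_sub_iff_add_eq, signedDegree]
    refine Eq.congr_right ?_
    module
  rw [← signedDegree_zero hG] at h0
  constructor
  · intro hp i
    refine Fin.cases ?_ (fun k => ?_) i
    · simpa using h0.1 (hp 0)
    · exact (hs k fun j _ => hp j).1 (hp _)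
  · intro hp i
    induction i using WellFoundedLT.induction with
    | ind i ih =>
      revert ih
      refine Fin.cases (fun _ => ?_) (fun k ih => ?_) i
      · exact h0.2 (by simpa using hp 0)
      · exact (hs k ih).2 (hp _)

theorem norm_resolventPoint_zero_sub_le (hA : IsMaximallyMonotone (A 0)) (hκ : 0 < degree G 0)
    (hγ : 0 < γ) (z z' : PiLp 2 fun _ : Fin m => X) :
    ‖resolventPoint G hG h hh A B M γ z 0 - resolventPoint G hG h hh A B M γ z' 0‖ ≤
      1 / (degree G 0 : ℝ) * ‖∑ e, M 0 e • (z - z') e‖ := by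
  have hκ' : (0 : ℝ) < degree G 0 := Nat.cast_pos.2 hκ
  obtain ⟨u, hu, hz⟩ := (hA.resolvent_eq_iff (div_pos hγ hκ')
    (y := (1 / (degree G 0 : ℝ)) • ∑ e, M 0 e • z e)).1 rfl
  obtain ⟨u', hu', hz'⟩ := (hA.resolvent_eq_iff (div_pos hγ hκ')
    (y := (1 / (degree G 0 : ℝ)) • ∑ e, M 0 e • z' e)).1 rfl
  have := hA.1.norm_sub_le (div_pos hγ hκ').le hu hu'
  rw [hz, hz', ← smul_sub, norm_smul, Real.norm_of_nonneg (one_div_pos.2 hκ').le,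
    ← Finset.sum_sub_distrib] at this
  simp only [← smul_sub] at this
  rw [resolventPoint, dif_pos rfl, resolventPoint, dif_pos rfl]
  exact this

end Method

/-! ### Relocation along a solution of `M a = c` -/

section Relocator
variable {X : Type*} [NormedAddCommGroup X] [InnerProductSpace ℝ X]
  {m : ℕ} {G : Digraph (Fin (m + 1))} {hG : ∀ i j, G.Adj i j → i < j}
  {h : Fin m → Fin (m + 1)} {hh : ∀ i, h i < i.succ}
  {A : Fin (m + 1) → X → Set X} {B : Fin m → X → X} {M : Matrix (Fin (m + 1)) (Fin m) ℝ}
  {γ δ ε θ : ℝ} {z : PiLp 2 fun _ : Fin m => X}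

/-- The operator `z ↦ (δ/γ) z + (1 - δ/γ) a ⊗ x₁ γ z` with coefficient vector `a`. -/
noncomputable def weightedRelocator (a : Fin m → ℝ) (x₁ : ℝ → (PiLp 2 fun _ : Fin m => X) → X)
    (δ γ : ℝ) (z : PiLp 2 fun _ : Fin m => X) : PiLp 2 fun _ : Fin m => X :=
  (δ / γ) • z + (1 - δ / γ) • WithLp.toLp 2 fun e => a e • x₁ γ z

/-- Relocation scales the residual `M z - c ⊗ x₁` by `δ / γ`, since `M a = c`. -/
theorem sum_smul_weightedRelocator {a : Fin m → ℝ} {c : Fin (m + 1) → ℝ}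
    (ha : M.mulVec a = c) (x₁ : ℝ → (PiLp 2 fun _ : Fin m => X) → X) (i : Fin (m + 1)) :
    ∑ e, M i e • weightedRelocator a x₁ δ γ z e - c i • x₁ γ z =
      (δ / γ) • (∑ e, M i e • z e - c i • x₁ γ z) := by
  have hc : c i • x₁ γ z = ∑ e, M i e • a e • x₁ γ z := by
    rw [← ha, Matrix.mulVec, dotProduct, Finset.sum_smul]
    simp only [mul_smul]
  rw [hc, ← Finset.sum_sub_distrib, ← Finset.sum_sub_distrib, Finset.smul_sum]
  refine Finset.sum_congr rfl fun e _ => ?_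
  simp only [weightedRelocator, PiLp.add_apply, PiLp.smul_apply]
  module

theorem smul_eq_div_smul {v w : X} (hγ : 0 < γ) (hv : γ • v = w) : δ • v = (δ / γ) • w := by
  rw [← hv, smul_smul, div_mul_cancel₀ _ hγ.ne']

/-- Fixed points of `T_{θ,γ}` are the `z` with coinciding resolvent points. The hypothesis `hker`
says that the graph with incidence matrix `M` is connected. -/
theorem mem_fixedPoints_iterationOperator_iff (hθ : 0 < θ)
    (hker : ∀ x : Fin (m + 1) → X, (∀ e, ∑ j, M j e • x j = 0) ↔ ∀ j, x j = x 0) :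
    z ∈ Function.fixedPoints (iterationOperator G hG h hh A B M θ γ) ↔
      ∀ j, resolventPoint G hG h hh A B M γ z j = resolventPoint G hG h hh A B M γ z 0 := by
  rw [← hker, Function.mem_fixedPoints, Function.IsFixedPt, PiLp.ext_iff]
  refine forall_congr' fun e => ?_
  simp [iterationOperator, hθ.ne']

variable [CompleteSpace X]

/-- Relocation preserves the first resolvent point, for arbitrary `z`: node `0` has in-degree `0`,
so its inclusion has the residual `(M z)_0 - c_0 x` whether or not `z` is a fixed point. -/
theorem resolventPoint_zero_weightedRelocator (hA : IsMaximallyMonotone (A 0))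
    (hκ : 0 < degree G 0) {a : Fin m → ℝ} (ha : M.mulVec a = signedDegree G)
    (hδ : 0 < δ) (hγ : 0 < γ) :
    resolventPoint G hG h hh A B M δ (weightedRelocator a
      (fun γ z => resolventPoint G hG h hh A B M γ z 0) δ γ z) 0 =
    resolventPoint G hG h hh A B M γ z 0 := by
  obtain ⟨u, hu, hz⟩ := (resolventPoint_zero_eq_iff (hG := hG) (h := h) (hh := hh) (B := B)
    (M := M) (z := z) hA hκ hγ).1 rfl
  rw [resolventPoint_zero_eq_iff hA hκ hδ]
  refine ⟨u, hu, ?_⟩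
  rw [← signedDegree_zero hG] at hz ⊢
  rw [sum_smul_weightedRelocator ha fun γ z => resolventPoint G hG h hh A B M γ z 0]
  exact smul_eq_div_smul hγ hz

theorem weightedRelocator_weightedRelocator (hA : IsMaximallyMonotone (A 0))
    (hκ : 0 < degree G 0) {a : Fin m → ℝ} (ha : M.mulVec a = signedDegree G)
    (hδ : 0 < δ) (hγ : 0 < γ) :
    weightedRelocator a (fun γ z => resolventPoint G hG h hh A B M γ z 0) ε δ
      (weightedRelocator a (fun γ z => resolventPoint G hG h hh A B M γ z 0) δ γ z) =
    weightedRelocator a (fun γ z => resolventPoint G hG h hh A B M γ z 0) ε γ z := by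
  have hx := resolventPoint_zero_weightedRelocator (hG := hG) (h := h) (hh := hh) (B := B)
    (z := z) hA hκ ha hδ hγ
  rw [weightedRelocator, hx, weightedRelocator, weightedRelocator]
  have e : ε / δ * (δ / γ) = ε / γ := div_mul_div_cancel₀ hδ.ne'
  rw [smul_add, smul_smul, smul_smul, e, add_assoc, ← add_smul, mul_sub, e]
  congr 2
  ring

theorem weightedRelocator_mem_fixedPoints (hA : ∀ i, IsMaximallyMonotone (A i))
    (hκ : ∀ i, 0 < degree G i) {a : Fin m → ℝ} (ha : M.mulVec a = signedDegree G)
    (hker : ∀ x : Fin (m + 1) → X, (∀ e, ∑ j, M j e • x j = 0) ↔ ∀ j, x j = x 0)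
    (hθ : 0 < θ) (hδ : 0 < δ) (hγ : 0 < γ)
    (hz : z ∈ Function.fixedPoints (iterationOperator G hG h hh A B M θ γ)) :
    weightedRelocator a (fun γ z => resolventPoint G hG h hh A B M γ z 0) δ γ z ∈
      Function.fixedPoints (iterationOperator G hG h hh A B M θ δ) := by
  rw [mem_fixedPoints_iterationOperator_iff hθ hker] at hz ⊢
  rw [resolventPoint_zero_weightedRelocator (hA 0) (hκ 0) ha hδ hγ]
  rw [resolventPoint_eq_const_iff hA hκ hγ] at hz
  rw [resolventPoint_eq_const_iff hA hκ hδ]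
  intro i
  obtain ⟨u, hu, hi⟩ := hz i
  refine ⟨u, hu, ?_⟩
  rw [sum_smul_weightedRelocator ha fun γ z => resolventPoint G hG h hh A B M γ z 0]
  exact smul_eq_div_smul hγ hi

theorem norm_weightedRelocator_sub_le (hA : IsMaximallyMonotone (A 0)) (hκ : 0 < degree G 0)
    (a : Fin m → ℝ) {ρ : ℝ} (hρ : ∀ z : PiLp 2 fun _ : Fin m => X, ‖∑ e, M 0 e • z e‖ ≤ ρ * ‖z‖)
    (hδ : 0 < δ) (hγ : 0 < γ) (z z' : PiLp 2 fun _ : Fin m => X) :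
    ‖weightedRelocator a (fun γ z => resolventPoint G hG h hh A B M γ z 0) δ γ z -
      weightedRelocator a (fun γ z => resolventPoint G hG h hh A B M γ z 0) δ γ z'‖ ≤
    (δ / γ + |1 - δ / γ| * (ρ / degree G 0) * √(∑ e, a e ^ 2)) * ‖z - z'‖ := by
  set x := resolventPoint G hG h hh A B M γ z 0 with hx
  set x' := resolventPoint G hG h hh A B M γ z' 0 with hx'
  have hdiff : weightedRelocator a (fun γ z => resolventPoint G hG h hh A B M γ z 0) δ γ z -
      weightedRelocator a (fun γ z => resolventPoint G hG h hh A B M γ z 0) δ γ z' =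
      (δ / γ) • (z - z') + (1 - δ / γ) • WithLp.toLp 2 fun e => a e • (x - x') := by
    ext e
    simp only [weightedRelocator, PiLp.add_apply, PiLp.smul_apply, PiLp.sub_apply, ← hx, ← hx']
    module
  have htensor : ‖(WithLp.toLp 2 fun e => a e • (x - x') : PiLp 2 fun _ : Fin m => X)‖ =
      √(∑ e, a e ^ 2) * ‖x - x'‖ := by
    rw [PiLp.norm_eq_of_L2]
    simp only [norm_smul, mul_pow, Real.norm_eq_abs, sq_abs, ← Finset.sum_mul]
    rw [Real.sqrt_mul (Finset.sum_nonneg fun _ _ => sq_nonneg _), Real.sqrt_sq (norm_nonneg _)]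
  have hxx : ‖x - x'‖ ≤ ρ / degree G 0 * ‖z - z'‖ := by
    refine (norm_resolventPoint_zero_sub_le hA hκ hγ z z').trans ?_
    calc 1 / (degree G 0 : ℝ) * ‖∑ e, M 0 e • (z - z') e‖
        ≤ 1 / (degree G 0 : ℝ) * (ρ * ‖z - z'‖) := by gcongr; exact hρ _
      _ = ρ / degree G 0 * ‖z - z'‖ := by ring
  calc _ ≤ ‖(δ / γ) • (z - z')‖ + ‖(1 - δ / γ) •
        (WithLp.toLp 2 fun e => a e • (x - x') : PiLp 2 fun _ : Fin m => X)‖ := by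
        rw [hdiff]; exact norm_add_le _ _
    _ = δ / γ * ‖z - z'‖ + |1 - δ / γ| * (√(∑ e, a e ^ 2) * ‖x - x'‖) := by
        rw [norm_smul, norm_smul, htensor, Real.norm_of_nonneg (div_pos hδ hγ).le,
          Real.norm_eq_abs]
    _ ≤ δ / γ * ‖z - z'‖ + |1 - δ / γ| * (√(∑ e, a e ^ 2) * (ρ / degree G 0 * ‖z - z'‖)) := by
        gcongr
    _ = _ := by ring

/-- If `M a = c` and the graph with incidence matrix `M` is connected, relocation with
coefficients `a` is a fixed-point relocator. Here `ρ` bounds the row of `M` at node `0`. -/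
theorem isFixedPointRelocator_weightedRelocator (hA : ∀ i, IsMaximallyMonotone (A i))
    (hκ : ∀ i, 0 < degree G i) {a : Fin m → ℝ} (ha : M.mulVec a = signedDegree G)
    (hker : ∀ x : Fin (m + 1) → X, (∀ e, ∑ j, M j e • x j = 0) ↔ ∀ j, x j = x 0)
    (hθ : 0 < θ) {ρ : ℝ}
    (hρ : ∀ z : PiLp 2 fun _ : Fin m => X, ‖∑ e, M 0 e • z e‖ ≤ ρ * ‖z‖)
    {L : ℝ → ℝ → ℝ} (hL₁ : ∀ δ γ, 1 ≤ L δ γ) (hL : ∀ δ γ, 0 < δ → 0 < γ →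
      δ / γ + |1 - δ / γ| * (ρ / degree G 0) * √(∑ e, a e ^ 2) ≤ L δ γ) :
    IsFixedPointRelocator (Set.Ioi 0) (iterationOperator G hG h hh A B M θ)
      (weightedRelocator a fun γ z => resolventPoint G hG h hh A B M γ z 0) L where
  nonempty := ⟨1, Set.mem_Ioi.2 one_pos⟩
  pos _ hγ := hγ
  one_le _ _ _ _ := hL₁ _ _
  bijOn γ hγ δ hδ := by
    have hinv : ∀ {γ δ : ℝ}, 0 < γ → 0 < δ → ∀ z, weightedRelocator a
        (fun γ z => resolventPoint G hG h hh A B M γ z 0) γ δ (weightedRelocator a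
        (fun γ z => resolventPoint G hG h hh A B M γ z 0) δ γ z) = z := by
      intro γ δ hγ hδ z
      rw [weightedRelocator_weightedRelocator (hA 0) (hκ 0) ha hδ hγ, weightedRelocator,
        div_self hγ.ne', sub_self, zero_smul, one_smul, add_zero]
    exact Set.InvOn.bijOn ⟨fun z _ => hinv hγ hδ z, fun z _ => hinv hδ hγ z⟩
      (fun z hz => weightedRelocator_mem_fixedPoints hA hκ ha hker hθ hδ hγ hz)
      (fun z hz => weightedRelocator_mem_fixedPoints hA hκ ha hker hθ hγ hδ hz)
  continuousOn γ _ z _ := by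
    unfold weightedRelocator
    fun_prop
  semigroup γ hγ δ hδ ε _ z _ :=
    weightedRelocator_weightedRelocator (hA 0) (hκ 0) ha hδ hγ
  lipschitz γ hγ δ hδ z z' :=
    (norm_weightedRelocator_sub_le (hA 0) (hκ 0) a hρ hδ hγ z z').trans
      (mul_le_mul_of_nonneg_right (hL δ γ hδ hγ) (norm_nonneg _))

end Relocator

/-! ### Stars and paths -/

section Trees
variable {m : ℕ} {c : Fin (m + 1) → ℝ}

theorem inwardStarArc_ne (e : Fin m) : (inwardStarArc m e).1 ≠ (inwardStarArc m e).2 :=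
  e.castSucc_lt_last.ne

theorem outwardStarArc_ne (e : Fin m) : (outwardStarArc m e).1 ≠ (outwardStarArc m e).2 :=
  e.succ_ne_zero.symm

theorem sequentialArc_ne (e : Fin m) : (sequentialArc m e).1 ≠ (sequentialArc m e).2 :=
  e.castSucc_lt_succ.ne

theorem mulVec_incidence_inwardStarArc (hc : ∑ i, c i = 0) :
    (incidence (inwardStarArc m)).mulVec (fun e => c e.castSucc) = c := by
  ext i
  simp only [Matrix.mulVec, dotProduct, incidence_apply_of_ne i (inwardStarArc_ne _),
    inwardStarArc]
  refine Fin.lastCases ?_ (fun k => ?_) i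
  · rw [Fin.sum_univ_castSucc] at hc
    simp [Fin.castSucc_ne_last]
    linarith
  · simp [(Fin.castSucc_ne_last k).symm]

theorem mulVec_incidence_outwardStarArc (hc : ∑ i, c i = 0) :
    (incidence (outwardStarArc m)).mulVec (fun e => -c e.succ) = c := by
  ext i
  simp only [Matrix.mulVec, dotProduct, incidence_apply_of_ne i (outwardStarArc_ne _),
    outwardStarArc]
  refine Fin.cases ?_ (fun k => ?_) i
  · rw [Fin.sum_univ_succ] at hc
    simp
    linarith
  · simp [(Fin.succ_ne_zero k).symm]

/-- By telescoping; the last node is the source of no arc, and the partial sum missing there is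
the full sum of `c`, which is `0`. -/
theorem mulVec_incidence_sequentialArc (hc : ∑ i, c i = 0) :
    (incidence (sequentialArc m)).mulVec (fun e => ∑ j ∈ Finset.Iic e.castSucc, c j) = c := by
  have hsrc : ∀ i, ∑ e : Fin m, (if e.castSucc = i then 1 else 0) * ∑ j ∈ Finset.Iic e.castSucc, c j =
      ∑ j ∈ Finset.Iic i, c j := by
    intro i
    refine Fin.lastCases ?_ (fun k => ?_) i
    · have : Finset.Iic (Fin.last m) = Finset.univ := by
        ext j; simp [Fin.le_last]
      simp [Fin.castSucc_ne_last, this, hc]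
    · simp
  have htgt : ∀ i, ∑ e : Fin m, (if e.succ = i then 1 else 0) * ∑ j ∈ Finset.Iic e.castSucc, c j =
      ∑ j ∈ Finset.Iic i, c j - c i := by
    intro i
    refine Fin.cases ?_ (fun k => ?_) i
    · have : Finset.Iic (0 : Fin (m + 1)) = {0} := by
        ext j; simp
      simp [this]
    · have : Finset.Iic k.succ = insert k.succ (Finset.Iic k.castSucc) := by
        ext j
        simp only [Finset.mem_Iic, Finset.mem_insert, Fin.ext_iff, Fin.le_def, Fin.val_succ,
          Fin.val_castSucc]
        omega
      rw [this, Finset.sum_insert (by simp)]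
      simp
  ext i
  simp only [Matrix.mulVec, dotProduct, incidence_apply_of_ne i (sequentialArc_ne _),
    sequentialArc, sub_mul, Finset.sum_sub_distrib]
  exact (congrArg₂ (· - ·) (hsrc i) (htgt i)).trans (sub_sub_cancel _ _)

variable {X : Type*} [NormedAddCommGroup X] [NormedSpace ℝ X]

theorem sum_incidence_inwardStarArc_eq_zero_iff (x : Fin (m + 1) → X) :
    (∀ e, ∑ j, incidence (inwardStarArc m) j e • x j = 0) ↔ ∀ j, x j = x 0 := by
  simp only [sum_incidence_smul (inwardStarArc_ne _), inwardStarArc, sub_eq_zero]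
  refine ⟨fun h => ?_, fun h e => (h _).trans (h _).symm⟩
  have h' : ∀ j, x j = x (Fin.last m) := fun j => Fin.lastCases rfl h j
  exact fun j => (h' j).trans (h' 0).symm

theorem sum_incidence_outwardStarArc_eq_zero_iff (x : Fin (m + 1) → X) :
    (∀ e, ∑ j, incidence (outwardStarArc m) j e • x j = 0) ↔ ∀ j, x j = x 0 := by
  simp only [sum_incidence_smul (outwardStarArc_ne _), outwardStarArc, sub_eq_zero]
  exact ⟨fun h j => Fin.cases rfl (fun k => (h k).symm) j, fun h e => (h _).symm⟩

theorem sum_incidence_sequentialArc_eq_zero_iff (x : Fin (m + 1) → X) :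
    (∀ e, ∑ j, incidence (sequentialArc m) j e • x j = 0) ↔ ∀ j, x j = x 0 := by
  simp only [sum_incidence_smul (sequentialArc_ne _), sequentialArc, sub_eq_zero]
  refine ⟨fun h j => ?_, fun h e => (h _).trans (h _).symm⟩
  induction j using Fin.induction with
  | zero => rfl
  | succ k ih => exact (h k).symm.trans ih

theorem norm_sum_incidence_zero_inwardStarArc_le (z : PiLp 2 fun _ : Fin m => X) :
    ‖∑ e, incidence (inwardStarArc m) 0 e • z e‖ ≤ 1 * ‖z‖ := by
  rw [one_mul]
  cases m with
  | zero => simp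
  | succ k =>
    have : ∀ e : Fin (k + 1), incidence (inwardStarArc (k + 1)) 0 e = if e = 0 then 1 else 0 := by
      intro e
      rw [incidence_apply_of_ne _ (inwardStarArc_ne _)]
      simp [inwardStarArc]
    simpa [this, ite_smul] using PiLp.norm_apply_le z 0

theorem norm_sum_incidence_zero_outwardStarArc_le (z : PiLp 2 fun _ : Fin m => X) :
    ‖∑ e, incidence (outwardStarArc m) 0 e • z e‖ ≤ √(m : ℝ) * ‖z‖ := by
  have : ∀ e : Fin m, incidence (outwardStarArc m) 0 e = 1 := by
    intro e
    rw [incidence_apply_of_ne _ (outwardStarArc_ne _)]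
    simp [outwardStarArc]
  simp only [this, one_smul]
  refine (norm_sum_le _ _).trans ?_
  rw [PiLp.norm_eq_of_L2, ← Real.sqrt_mul (Nat.cast_nonneg m)]
  refine Real.le_sqrt_of_sq_le ?_
  simpa using sq_sum_le_card_mul_sum_sq (s := Finset.univ) (f := fun e => ‖z e‖)

theorem norm_sum_incidence_zero_sequentialArc_le (z : PiLp 2 fun _ : Fin m => X) :
    ‖∑ e, incidence (sequentialArc m) 0 e • z e‖ ≤ 1 * ‖z‖ := by
  rw [one_mul]
  cases m with
  | zero => simp
  | succ k =>
    have : ∀ e : Fin (k + 1), incidence (sequentialArc (k + 1)) 0 e = if e = 0 then 1 else 0 := by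
      intro e
      rw [incidence_apply_of_ne _ (sequentialArc_ne _)]
      simp [sequentialArc]
    simpa [this, ite_smul] using PiLp.norm_apply_le z 0

end Trees

end GraphFB

open GraphFB
theorem propositionp {X : Type*} [NormedAddCommGroup X] [InnerProductSpace ℝ X] [CompleteSpace X]
    -- the nodes are `1, …, n` with `n = m + 1 ≥ 2`
    (m : ℕ) (hm : 1 ≤ m)
    (G : Digraph (Fin (m + 1))) (hG : ∀ i j, G.Adj i j → i < j)
    (hconn : G.toSimpleGraphInclusive.Connected)
    (h : Fin m → Fin (m + 1)) (hh : ∀ i, h i < i.succ)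
    (A : Fin (m + 1) → X → Set X) (hA : ∀ i, IsMaximallyMonotone (A i))
    (β : ℝ) (hβ : 0 < β) (B : Fin m → X → X) (hB : ∀ i, IsCocoercive β (B i)) :
    (digraphOfArcs (inwardStarArc m) ≤ G →
      (∀ θ : ℝ, 0 < θ →
        IsFixedPointRelocator (Set.Ioi 0)
          (iterationOperator G hG h hh A B (incidence (inwardStarArc m)) θ)
          (inwardStarRelocator G fun γ z => resolventPoint G hG h hh A B (incidence (inwardStarArc m)) γ z 0)
          (inwardStarLipschitz G)) ∧
      ∀ δ γ : ℝ, 0 < δ → 0 < γ → ∀ z : PiLp 2 fun _ : Fin m => X,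
        resolventPoint G hG h hh A B (incidence (inwardStarArc m)) γ z 0 =
          resolventPoint G hG h hh A B (incidence (inwardStarArc m)) δ
            (inwardStarRelocator G
              (fun γ z => resolventPoint G hG h hh A B (incidence (inwardStarArc m)) γ z 0) δ γ z) 0) ∧
    (digraphOfArcs (outwardStarArc m) ≤ G →
      (∀ θ : ℝ, 0 < θ →
        IsFixedPointRelocator (Set.Ioi 0)
          (iterationOperator G hG h hh A B (incidence (outwardStarArc m)) θ)
          (outwardStarRelocator G fun γ z => resolventPoint G hG h hh A B (incidence (outwardStarArc m)) γ z 0)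
          (outwardStarLipschitz G)) ∧
      ∀ δ γ : ℝ, 0 < δ → 0 < γ → ∀ z : PiLp 2 fun _ : Fin m => X,
        resolventPoint G hG h hh A B (incidence (outwardStarArc m)) γ z 0 =
          resolventPoint G hG h hh A B (incidence (outwardStarArc m)) δ
            (outwardStarRelocator G
              (fun γ z => resolventPoint G hG h hh A B (incidence (outwardStarArc m)) γ z 0) δ γ z) 0) ∧
    (digraphOfArcs (sequentialArc m) ≤ G →
      (∀ θ : ℝ, 0 < θ →
        IsFixedPointRelocator (Set.Ioi 0)
          (iterationOperator G hG h hh A B (incidence (sequentialArc m)) θ)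
          (sequentialRelocator G fun γ z => resolventPoint G hG h hh A B (incidence (sequentialArc m)) γ z 0)
          (sequentialLipschitz G)) ∧
      ∀ δ γ : ℝ, 0 < δ → 0 < γ → ∀ z : PiLp 2 fun _ : Fin m => X,
        resolventPoint G hG h hh A B (incidence (sequentialArc m)) γ z 0 =
          resolventPoint G hG h hh A B (incidence (sequentialArc m)) δ
            (sequentialRelocator G
              (fun γ z => resolventPoint G hG h hh A B (incidence (sequentialArc m)) γ z 0) δ γ z) 0) := by
  have hκ : ∀ i, 0 < degree G i := degree_pos_of_connected hm hconn
  have hc := sum_signedDegree hG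
  refine ⟨fun _ => ?_, fun _ => ?_, fun _ => ?_⟩
  · have ha := mulVec_incidence_inwardStarArc hc
    refine ⟨fun θ hθ => isFixedPointRelocator_weightedRelocator hA hκ ha
      sum_incidence_inwardStarArc_eq_zero_iff hθ norm_sum_incidence_zero_inwardStarArc_le
      (fun _ _ => le_max_left _ _) fun δ γ _ _ => le_max_of_le_right ?_,
      fun δ γ hδ hγ z => (resolventPoint_zero_weightedRelocator (hA 0) (hκ 0) ha hδ hγ).symm⟩
    -- The stated constant carries an additional summand `κ₁ ^ 2` under the square root.
    gcongr
    exact le_add_of_nonneg_left (sq_nonneg _)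
  · have ha := mulVec_incidence_outwardStarArc hc
    have hQ : outwardStarRelocator G
        (fun γ z => resolventPoint G hG h hh A B (incidence (outwardStarArc m)) γ z 0) =
        weightedRelocator (fun e => -signedDegree G e.succ)
          fun γ z => resolventPoint G hG h hh A B (incidence (outwardStarArc m)) γ z 0 := by
      funext δ γ z
      ext e
      simp only [outwardStarRelocator, weightedRelocator, PiLp.add_apply, PiLp.sub_apply,
        PiLp.smul_apply]
      module
    rw [hQ]
    refine ⟨fun θ hθ => isFixedPointRelocator_weightedRelocator hA hκ ha
      sum_incidence_outwardStarArc_eq_zero_iff hθ norm_sum_incidence_zero_outwardStarArc_le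
      (fun _ _ => le_max_left _ _) fun δ γ _ _ => le_max_of_le_right ?_,
      fun δ γ hδ hγ z => (resolventPoint_zero_weightedRelocator (hA 0) (hκ 0) ha hδ hγ).symm⟩
    simp only [neg_sq]
    exact le_rfl
  · have ha := mulVec_incidence_sequentialArc hc
    exact ⟨fun θ hθ => isFixedPointRelocator_weightedRelocator hA hκ ha
      sum_incidence_sequentialArc_eq_zero_iff hθ norm_sum_incidence_zero_sequentialArc_le
      (fun _ _ => le_max_left _ _) fun δ γ _ _ => le_max_right _ _,
      fun δ γ hδ hγ z => (resolventPoint_zero_weightedRelocator (hA 0) (hκ 0) ha hδ hγ).symm⟩
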